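/- **Theorem.** Let $(X,\mathscr A,\mu)$ be a $\sigma$-finite measure space, let $\phi\colon X\to X$ and $w\colon X\to\mathbb C$ be $\mathscr A$-measurable, and put $\mu_w(\sigma)=\int_\sigma|w|^2\,d\mu$ for $\sigma\in\mathscr A$. Assume that $\mu_w\circ\phi^{-1}\ll\mu$, so that the (possibly unbounded) weighted composition operator $C_{\phi,w}f=w\cdot(f\circ\phi)$ in the complex space $L^2(\mu)$, with domain $\{f\in L^2(\mu)\colon w\cdot(f\circ\phi)\in L^2(\mu)\}$, is well defined. For $n\geqslant 1$ let $w_n=\prod_{j=0}^{n-1}w\circ\phi^j$ and let $\mathsf h_n=\mathsf h_{\phi^n,w_n}\colon X\to[0,\infty]$ be the Radon–Nikodym derivative of $\mu_{w_n}\circ(\phi^n)^{-1}$ with respect to $\mu$. Let $\mathsf E_{\phi,w}$ denote the conditional expectation with respect to the $\sigma$-algebra $\phi^{-1}(\mathscr A)$ and the measure $\mu_w$ (acting on $[0,\infty]$-valued measurable functions and on $L^2(\mu_w)$), and let $\mathsf P_{\phi,w}f=w\,\mathsf E_{\phi,w}(f_w)$ for $f\in L^2(\mu)$, where $f_w=f/w$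 on $\{w\neq0\}$ and $f_w=0$ on $\{w=0\}$; $\mathsf P_{\phi,w}$ is an orthogonal projection in $L^2(\mu)$. For measurable $g$, let $M_g$ be the operator $f\mapsto gf$ in $L^2(\mu)$ with domain $\{f\in L^2(\mu)\colon gf\in L^2(\mu)\}$. Assume that for every integer $n\geqslant1$ the power $C_{\phi,w}^n$ (with its natural domain) is densely defined and closed; then each $\mathsf h_n$ is finite a.e. $[\mu]$. The following two conditions are equivalent: 1. for every $n\geqslant1$, $\mathsf P_{\phi,w}M_{\mathsf h_n}\subseteq M_{\mathsf h_n}\mathsf P_{\phi,w}$ (inclusion of operators, with the natural domains of the products); 2. for every $n\geqslant1$, $\mathsf E_{\phi,w}(\mathsf h_n)=\mathsf h_n$ a.e. $[\mu_w]$. -/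

import Mathlib

open MeasureTheory
open scoped ENNReal

noncomputable section

namespace WCO

/-! Unbounded operators: composition and powers with their natural domains. -/

section PartialOperators

variable {H : Type*} [AddCommGroup H] [Module ℂ H]

/-- The product `S T` of two partially defined operators, with its natural domain
`{x ∈ D(T) : T x ∈ D(S)}`. -/
def pcomp (S T : H →ₗ.[ℂ] H) : H →ₗ.[ℂ] H where
  domain := (S.domain.comap T.toFun).map T.domain.subtype
  toFun :=
    { toFun := fun x =>
        S ⟨T ⟨x.1, by obtain ⟨y, -, hy⟩ := x.2; rw [← hy]; exact y.2⟩, by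
          obtain ⟨x, y, hy, rfl⟩ := x; exact hy⟩
      map_add' := fun x y => by
        rw [← S.map_add]
        congr 1
        apply Subtype.ext
        change T _ = T _ + T _
        rw [← T.map_add]
        rfl
      map_smul' := fun c x => by
        rw [RingHom.id_apply, ← S.map_smul]
        congr 1
        apply Subtype.ext
        change T _ = c • T _
        rw [← T.map_smul]
        rfl }

/-- Powers of a partially defined operator: `T⁰ = I` on the whole space, `Tⁿ⁺¹ = T Tⁿ`. -/
def ppow (T : H →ₗ.[ℂ] H) : ℕ → (H →ₗ.[ℂ] H)
  | 0 => (LinearMap.id : H →ₗ[ℂ] H).toPMap ⊤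
  | n + 1 => pcomp T (ppow T n)

theorem mem_pcomp_domain {S T : H →ₗ.[ℂ] H} {x : H} :
    x ∈ (pcomp S T).domain ↔ ∃ h : x ∈ T.domain, T ⟨x, h⟩ ∈ S.domain := by
  constructor
  · rintro ⟨y, hy, rfl⟩
    exact ⟨y.2, hy⟩
  · rintro ⟨h, hx⟩
    exact ⟨⟨x, h⟩, hx, rfl⟩

theorem pcomp_apply {S T : H →ₗ.[ℂ] H} {x : H} (h : x ∈ T.domain) (h' : T ⟨x, h⟩ ∈ S.domain) :
    pcomp S T ⟨x, mem_pcomp_domain.2 ⟨h, h'⟩⟩ = S ⟨T ⟨x, h⟩, h'⟩ := rfl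

end PartialOperators

variable {X : Type*} [MeasurableSpace X]

/-- The measure `μ_w(σ) = ∫_σ |w|² dμ`. -/
def weightedMeasure (μ : Measure X) (w : X → ℂ) : Measure X :=
  μ.withDensity (fun x => ‖w x‖ₑ ^ 2)

/-- The weight `w_n = ∏_{j<n} w ∘ φʲ`, so that `w_0 = 1` and `w_1 = w`. -/
def weight (φ : X → X) (w : X → ℂ) (n : ℕ) : X → ℂ :=
  fun x => ∏ j ∈ Finset.range n, w (φ^[j] x)

/-- The Radon-Nikodym derivative `h_{φ,w} : X → [0,∞]` of `μ_w ∘ φ⁻¹` with respect to `μ`. -/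
def rnd (μ : Measure X) (φ : X → X) (w : X → ℂ) : X → ℝ≥0∞ :=
  ((weightedMeasure μ w).map φ).rnDeriv μ

/-- `h_n = h_{φⁿ, w_n}`. -/
def hn (μ : Measure X) (φ : X → X) (w : X → ℂ) (n : ℕ) : X → ℝ≥0∞ :=
  rnd μ (φ^[n]) (weight φ w n)

theorem ae_mul_of_ae_weighted {μ : Measure X} {w : X → ℂ} (hw : Measurable w) {f g : X → ℂ}
    (h : f =ᵐ[weightedMeasure μ w] g) : (fun x => w x * f x) =ᵐ[μ] fun x => w x * g x := by
  have h' := (ae_withDensity_iff (by fun_prop)).1 h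
  filter_upwards [h'] with x hx
  by_cases h0 : w x = 0
  · simp [h0]
  · rw [hx (by simpa using h0)]

theorem eLpNorm_mul_weight (μ : Measure X) {w : X → ℂ} (hw : Measurable w) {g : X → ℂ}
    (hg : Measurable g) :
    eLpNorm (fun x => w x * g x) 2 μ = eLpNorm g 2 (weightedMeasure μ w) := by
  rw [eLpNorm_eq_lintegral_rpow_enorm_toReal (by simp) (by simp),
    eLpNorm_eq_lintegral_rpow_enorm_toReal (by simp) (by simp), weightedMeasure,
    lintegral_withDensity_eq_lintegral_mul _ (by fun_prop) (by fun_prop)]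
  simp [enorm_mul, mul_pow]

theorem weightedMeasure_absolutelyContinuous (μ : Measure X) (w : X → ℂ) :
    weightedMeasure μ w ≪ μ :=
  withDensity_absolutelyContinuous _ _

/-- If `μ_w ∘ φ⁻¹ ≪ μ`, then the class of `w · (f ∘ φ)` depends only on the class of `f`. -/
theorem ae_wco {μ : Measure X} {φ : X → X} {w : X → ℂ} (hφ : Measurable φ) (hw : Measurable w)
    (hac : (weightedMeasure μ w).map φ ≪ μ) {f g : X → ℂ} (h : f =ᵐ[μ] g) :
    (fun x => w x * f (φ x)) =ᵐ[μ] fun x => w x * g (φ x) :=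
  ae_mul_of_ae_weighted hw (f := f ∘ φ) (g := g ∘ φ) (ae_of_ae_map hφ.aemeasurable (hac.ae_le h))

/-- The weighted composition operator `C_{φ,w} f = w · (f ∘ φ)` in `L²(μ)`, with domain
`{f ∈ L²(μ) : w · (f ∘ φ) ∈ L²(μ)}`. -/
def wco (μ : Measure X) (φ : X → X) (w : X → ℂ) (hφ : Measurable φ) (hw : Measurable w)
    (hac : (weightedMeasure μ w).map φ ≪ μ) : Lp ℂ 2 μ →ₗ.[ℂ] Lp ℂ 2 μ where
  domain :=
    { carrier := {f | MemLp (fun x => w x * f (φ x)) 2 μ}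
      zero_mem' := by
        refine (memLp_congr_ae ?_).2 (MemLp.zero (p := 2) (μ := μ) (ε := ℂ))
        filter_upwards [ae_wco hφ hw hac (Lp.coeFn_zero ℂ 2 μ)] with x hx
        simpa using hx
      add_mem' := fun {f g} hf hg => by
        refine (memLp_congr_ae ?_).2 (MemLp.add hf hg)
        filter_upwards [ae_wco hφ hw hac (Lp.coeFn_add f g)] with x hx
        simpa [mul_add] using hx
      smul_mem' := fun c f hf => by
        refine (memLp_congr_ae ?_).2 (MemLp.const_smul hf c)
        filter_upwards [ae_wco hφ hw hac (Lp.coeFn_smul c f)] with x hx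
        simpa [mul_left_comm] using hx }
  toFun :=
    { toFun := fun f => MemLp.toLp (fun x => w x * f.1 (φ x)) f.2
      map_add' := fun f g => by
        rw [← MemLp.toLp_add]
        refine MemLp.toLp_congr _ _ ?_
        filter_upwards [ae_wco hφ hw hac (Lp.coeFn_add f.1 g.1)] with x hx
        simpa [mul_add] using hx
      map_smul' := fun c f => by
        rw [RingHom.id_apply, ← MemLp.toLp_const_smul]
        refine MemLp.toLp_congr _ _ ?_
        filter_upwards [ae_wco hφ hw hac (Lp.coeFn_smul c f.1)] with x hx
        simpa [mul_left_comm] using hx }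

/-- The multiplication operator `M_g f = g · f` in `L²(μ)`, with domain
`{f ∈ L²(μ) : g · f ∈ L²(μ)}`. -/
def mulOp (μ : Measure X) (g : X → ℂ) : Lp ℂ 2 μ →ₗ.[ℂ] Lp ℂ 2 μ where
  domain :=
    { carrier := {f | MemLp (fun x => g x * f x) 2 μ}
      zero_mem' := by
        refine (memLp_congr_ae ?_).2 (MemLp.zero (p := 2) (μ := μ) (ε := ℂ))
        filter_upwards [Lp.coeFn_zero ℂ 2 μ] with x hx
        simp only [hx, Pi.zero_apply, mul_zero]
      add_mem' := fun {f k} hf hk => by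
        refine (memLp_congr_ae ?_).2 (MemLp.add hf hk)
        filter_upwards [Lp.coeFn_add f k] with x hx
        simp only [hx, Pi.add_apply, mul_add]
      smul_mem' := fun c f hf => by
        refine (memLp_congr_ae ?_).2 (MemLp.const_smul hf c)
        filter_upwards [Lp.coeFn_smul c f] with x hx
        simp only [hx, Pi.smul_apply, smul_eq_mul, mul_left_comm] }
  toFun :=
    { toFun := fun f => MemLp.toLp (fun x => g x * f.1 x) f.2
      map_add' := fun f k => by
        rw [← MemLp.toLp_add]
        refine MemLp.toLp_congr _ _ ?_
        filter_upwards [Lp.coeFn_add f.1 k.1] with x hx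
        simp only [Submodule.coe_add, hx, Pi.add_apply, mul_add]
      map_smul' := fun c f => by
        rw [RingHom.id_apply, ← MemLp.toLp_const_smul]
        refine MemLp.toLp_congr _ _ ?_
        filter_upwards [Lp.coeFn_smul c f.1] with x hx
        simp only [Submodule.coe_smul, hx, Pi.smul_apply, smul_eq_mul, mul_left_comm] }

/-- The operator `M_h` for a `[0,∞]`-valued `h` that is finite almost everywhere. -/
def mulOpENNReal (μ : Measure X) (h : X → ℝ≥0∞) : Lp ℂ 2 μ →ₗ.[ℂ] Lp ℂ 2 μ :=
  mulOp μ (fun x => ((h x).toReal : ℂ))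

theorem memLp_div_weight {μ : Measure X} {w : X → ℂ} (hw : Measurable w) (f : Lp ℂ 2 μ) :
    MemLp (fun x => f x / w x) 2 (weightedMeasure μ w) := by
  have hf : Measurable (f : X → ℂ) := (Lp.stronglyMeasurable f).measurable
  refine ⟨(hf.div hw).aestronglyMeasurable, ?_⟩
  rw [← eLpNorm_mul_weight μ hw (g := fun x => f x / w x) (hf.div hw)]
  refine (eLpNorm_mono fun x => ?_).trans_lt (Lp.memLp f).2
  by_cases h0 : w x = 0
  · simp [h0]
  · rw [mul_div_cancel₀ _ h0]

theorem memLp_mul_weight {μ : Measure X} {w : X → ℂ} (hw : Measurable w)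
    (g : Lp ℂ 2 (weightedMeasure μ w)) : MemLp (fun x => w x * g x) 2 μ := by
  have hg : Measurable (g : X → ℂ) := (Lp.stronglyMeasurable g).measurable
  refine ⟨(hw.mul hg).aestronglyMeasurable, ?_⟩
  rw [eLpNorm_mul_weight μ hw hg]
  exact (Lp.memLp g).2

/-- The map `f ↦ f_w` from `L²(μ)` to `L²(μ_w)`, where `f_w = f / w` on `{w ≠ 0}` and `f_w = 0`
on `{w = 0}` (division by zero gives zero). -/
def divWeight (μ : Measure X) (w : X → ℂ) (hw : Measurable w) :
    Lp ℂ 2 μ →ₗ[ℂ] Lp ℂ 2 (weightedMeasure μ w) where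
  toFun f := MemLp.toLp (fun x => f x / w x) (memLp_div_weight hw f)
  map_add' f g := by
    rw [← MemLp.toLp_add]
    refine MemLp.toLp_congr _ _ ?_
    filter_upwards [(weightedMeasure_absolutelyContinuous μ w).ae_le (Lp.coeFn_add f g)] with x hx
    simp only [hx, Pi.add_apply, add_div]
  map_smul' c f := by
    rw [RingHom.id_apply, ← MemLp.toLp_const_smul]
    refine MemLp.toLp_congr _ _ ?_
    filter_upwards [(weightedMeasure_absolutelyContinuous μ w).ae_le (Lp.coeFn_smul c f)] with x hx
    simp only [hx, Pi.smul_apply, smul_eq_mul, mul_div_assoc]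

/-- The map `g ↦ w g` from `L²(μ_w)` to `L²(μ)`. -/
def mulWeight (μ : Measure X) (w : X → ℂ) (hw : Measurable w) :
    Lp ℂ 2 (weightedMeasure μ w) →ₗ[ℂ] Lp ℂ 2 μ where
  toFun g := MemLp.toLp (fun x => w x * g x) (memLp_mul_weight hw g)
  map_add' f g := by
    rw [← MemLp.toLp_add]
    refine MemLp.toLp_congr _ _ ?_
    filter_upwards [ae_mul_of_ae_weighted hw (Lp.coeFn_add f g)] with x hx
    simpa [mul_add] using hx
  map_smul' c f := by
    rw [RingHom.id_apply, ← MemLp.toLp_const_smul]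
    refine MemLp.toLp_congr _ _ ?_
    filter_upwards [ae_mul_of_ae_weighted hw (Lp.coeFn_smul c f)] with x hx
    simpa [mul_left_comm] using hx

/-- `E_{φ,w}` on `[0,∞]`-valued functions: the conditional expectation with respect to the
σ-algebra `φ⁻¹(𝒜)` and the measure `μ_w`. -/
def condE (μ : Measure X) (φ : X → X) (w : X → ℂ) (f : X → ℝ≥0∞) : X → ℝ≥0∞ :=
  condLExp (MeasurableSpace.comap φ inferInstance) (weightedMeasure μ w) f

/-- `E_{φ,w}` on `L²(μ_w)`: the conditional expectation of a square integrable function with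
respect to the σ-algebra `φ⁻¹(𝒜)` and the measure `μ_w`. -/
def condE2 (μ : Measure X) (φ : X → X) (w : X → ℂ) (hφ : Measurable φ) :
    Lp ℂ 2 (weightedMeasure μ w) →ₗ[ℂ] Lp ℂ 2 (weightedMeasure μ w) where
  toFun f := (condExpL2 ℂ ℂ hφ.comap_le f : Lp ℂ 2 (weightedMeasure μ w))
  map_add' f g := by simp
  map_smul' c f := by simp

/-- The operator `P_{φ,w} f = w · E_{φ,w}(f_w)` on `L²(μ)`. -/
def proj (μ : Measure X) (φ : X → X) (w : X → ℂ) (hφ : Measurable φ) (hw : Measurable w) :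
    Lp ℂ 2 μ →ₗ[ℂ] Lp ℂ 2 μ :=
  mulWeight μ w hw ∘ₗ condE2 μ φ w hφ ∘ₗ divWeight μ w hw

end WCO

end

/-!
Write `ν = μ_w` and `E` for the conditional expectation on `L²(ν)` with respect to `φ⁻¹(𝒜)`, so
that `P f = w E(f / w)`. The two conditions are equivalent for each `n` separately, because each
says that `h = hₙ` is `φ⁻¹(𝒜)`-measurable up to a `ν`-null set.

* If `E(h) = h`, then `h` is a.e. `φ⁻¹(𝒜)`-measurable, and the pull-out property (`condExpL2_mul`)
  gives `P (h f) = h P f` whenever `f` and `h f` are in `L²(μ)`. This is the inclusion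
  `P M_h ⊆ M_h P` (`pcomp_proj_mulOp_le_iff`). The pull-out property is proved for bounded factors
  from the fact that `E` is an orthogonal projection, and then by cutting the factor off.
* Conversely, let `P M_h ⊆ M_h P`. Choose a `φ⁻¹(𝒜)`-measurable `s > 0` in `L²(ν)` and put
  `f = w s / (1 + h)`. Then `f` and `h f` are in `L²(μ)`, and `P f + h P f = P (f + h f) = P (w s)
  = w s`, that is, `(1 + h) E(s / (1 + h)) = s`. Hence `h = s / E(s / (1 + h)) - 1` is a.e.
  `φ⁻¹(𝒜)`-measurable (`aestronglyMeasurable_of_proj_mul`).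

The second part needs `h < ∞` a.e., and it needs `ν` to be σ-finite on `φ⁻¹(𝒜)`, for `s` to exist
and for the conditional expectation of `[0,∞]`-valued functions not to be zero by convention. The
density of the domains of the powers of `C_{φ,w}` gives both: it forces `hₙ < ∞` a.e. for every
`n ≥ 1` (`hn_lt_top`), and `h₁ < ∞` a.e. means that `ν ∘ φ⁻¹ = h₁ μ` is σ-finite.
-/

namespace WCO

/-! ### Conditional expectation on `L²` of a sub-σ-algebra -/

section CondExpL2

variable {X : Type*} {m m0 : MeasurableSpace X} {μ : Measure X}

/-- `condExpL2 f` is the only `m`-measurable `u` with `f - u` orthogonal to all `m`-measurable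
functions. -/
theorem condExpL2_eq_of_mem_of_inner (hm : m ≤ m0) {f u : Lp ℂ 2 μ}
    (hu : AEStronglyMeasurable[m] u μ)
    (h : ∀ v : Lp ℂ 2 μ, AEStronglyMeasurable[m] v μ → inner ℂ (f - u) v = 0) :
    (condExpL2 ℂ ℂ hm f : Lp ℂ 2 μ) = u := by
  have : Fact (m ≤ m0) := ⟨hm⟩
  refine Submodule.eq_starProjection_of_mem_of_inner_eq_zero
    (K := lpMeas ℂ ℂ m 2 μ) (mem_lpMeas_iff_aestronglyMeasurable.2 hu) fun v hv => ?_
  exact h v (mem_lpMeas_iff_aestronglyMeasurable.1 hv)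

theorem condExpL2_of_aestronglyMeasurable (hm : m ≤ m0) {f : Lp ℂ 2 μ}
    (hf : AEStronglyMeasurable[m] f μ) : (condExpL2 ℂ ℂ hm f : Lp ℂ 2 μ) = f :=
  condExpL2_eq_of_mem_of_inner hm hf fun v _ => by simp

theorem condExpL2_mul_of_bounded (hm : m ≤ m0) {g : X → ℂ} (hg : StronglyMeasurable[m] g)
    {C : ℝ} (hC : ∀ x, ‖g x‖ ≤ C) {f k : Lp ℂ 2 μ} (hk : k =ᵐ[μ] fun x => g x * f x) :
    (condExpL2 ℂ ℂ hm k : X → ℂ) =ᵐ[μ] fun x => g x * (condExpL2 ℂ ℂ hm f : X → ℂ) x := by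
  have hgs : StronglyMeasurable[m] fun x => star (g x) := continuous_star.comp_stronglyMeasurable hg
  have hL (v : Lp ℂ 2 μ) : MemLp (fun x => g x * v x) 2 μ :=
    (Lp.memLp v).of_le_mul (c := C)
      ((hg.mono hm).aestronglyMeasurable.mul (Lp.aestronglyMeasurable v))
      (ae_of_all _ fun x => by rw [norm_mul]; gcongr; exact hC x)
  have hL' (v : Lp ℂ 2 μ) : MemLp (fun x => star (g x) * v x) 2 μ :=
    (Lp.memLp v).of_le_mul (c := C)
      ((hgs.mono hm).aestronglyMeasurable.mul (Lp.aestronglyMeasurable v))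
      (ae_of_all _ fun x => by rw [norm_mul, norm_star]; gcongr; exact hC x)
  have key : (condExpL2 ℂ ℂ hm k : Lp ℂ 2 μ) = (hL (condExpL2 ℂ ℂ hm f)).toLp := by
    refine condExpL2_eq_of_mem_of_inner hm ?_ fun v hv => ?_
    · exact (hg.aestronglyMeasurable.mul (aestronglyMeasurable_condExpL2 hm f)).congr
        (hL (condExpL2 ℂ ℂ hm f)).coeFn_toLp.symm
    · have h1 : inner ℂ (k - (hL (condExpL2 ℂ ℂ hm f)).toLp) v =
          inner ℂ (f - (condExpL2 ℂ ℂ hm f : Lp ℂ 2 μ)) (hL' v).toLp := by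
        rw [L2.inner_def, L2.inner_def]
        refine integral_congr_ae ?_
        filter_upwards [hk, Lp.coeFn_sub k (hL (condExpL2 ℂ ℂ hm f)).toLp,
          Lp.coeFn_sub f (condExpL2 ℂ ℂ hm f : Lp ℂ 2 μ), (hL' v).coeFn_toLp,
          (hL (condExpL2 ℂ ℂ hm f)).coeFn_toLp] with x h1 h2 h3 h4 h5
        simp only [h2, h3, h4, h1, h5, Pi.sub_apply, RCLike.inner_apply, map_sub, map_mul]
        simp only [Complex.star_def]
        ring
      rw [h1, inner_sub_left, inner_condExpL2_eq_inner_fun hm, sub_self]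
      exact (hgs.aestronglyMeasurable.mul hv).congr (hL' v).coeFn_toLp.symm
  rw [key]
  exact (hL (condExpL2 ℂ ℂ hm f)).coeFn_toLp

/-- The pull-out property. Unlike the one for `condExp`, it asks for no integrability, nor for
σ-finiteness of the measure on the sub-σ-algebra. -/
theorem condExpL2_mul (hm : m ≤ m0) {g : X → ℂ} (hg : AEStronglyMeasurable[m] g μ)
    {f k : Lp ℂ 2 μ} (hk : k =ᵐ[μ] fun x => g x * f x) :
    (condExpL2 ℂ ℂ hm k : X → ℂ) =ᵐ[μ] fun x => g x * (condExpL2 ℂ ℂ hm f : X → ℂ) x := by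
  obtain ⟨g', hg', hgg'⟩ := hg
  have hs (N : ℕ) : MeasurableSet[m] {x | ‖g' x‖ ≤ N} :=
    hg'.norm.measurable measurableSet_Iic
  have hL (N : ℕ) : MemLp ({x | ‖g' x‖ ≤ N}.indicator k) 2 μ :=
    (Lp.memLp k).indicator (hm _ (hs N))
  -- On `{‖g‖ ≤ N}` both sides are conditional expectations of the bounded multiple
  -- `1_{‖g‖ ≤ N} g f` of `f`.
  have h1 (N : ℕ) : (condExpL2 ℂ ℂ hm (hL N).toLp : X → ℂ) =ᵐ[μ]
      fun x => {x | ‖g' x‖ ≤ N}.indicator 1 x * (condExpL2 ℂ ℂ hm k : X → ℂ) x := by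
    refine condExpL2_mul_of_bounded hm (C := 1)
      (stronglyMeasurable_one.indicator (hs N)) (fun x => ?_) ?_
    · by_cases hx : ‖g' x‖ ≤ N <;> simp [Set.indicator, hx]
    · filter_upwards [(hL N).coeFn_toLp] with x hx
      rw [hx]
      by_cases hx : ‖g' x‖ ≤ N <;> simp [Set.indicator, hx]
  have h2 (N : ℕ) : (condExpL2 ℂ ℂ hm (hL N).toLp : X → ℂ) =ᵐ[μ]
      fun x => {x | ‖g' x‖ ≤ N}.indicator g' x * (condExpL2 ℂ ℂ hm f : X → ℂ) x := by
    refine condExpL2_mul_of_bounded hm (C := N) (hg'.indicator (hs N)) (fun x => ?_) ?_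
    · by_cases hx : ‖g' x‖ ≤ N <;> simp [Set.indicator, hx]
    · filter_upwards [(hL N).coeFn_toLp, hk, hgg'] with x hx hkx hgx
      rw [hx]
      by_cases hx : ‖g' x‖ ≤ N <;> simp [Set.indicator, hx, hkx, hgx]
  filter_upwards [ae_all_iff.2 h1, ae_all_iff.2 h2, hgg'] with x hx1 hx2 hgx
  obtain ⟨N, hN⟩ := exists_nat_ge ‖g' x‖
  have := (hx1 N).symm.trans (hx2 N)
  simpa [Set.indicator, hN, hgx] using this

/-- The square root of a positive integrable function is a positive function in `L²`. -/
theorem exists_pos_sq_integrable (hm : m ≤ m0) [SigmaFinite (μ.trim hm)] :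
    ∃ s : X → ℝ, Measurable[m] s ∧ (∀ x, 0 < s x) ∧ MemLp s 2 μ := by
  obtain ⟨g, hpos, hg, hlt⟩ := @exists_pos_lintegral_lt_of_sigmaFinite X m (μ.trim hm) _ 1 one_ne_zero
  have hs : Measurable[m] fun x => Real.sqrt (g x) := hg.coe_nnreal_real.sqrt
  refine ⟨fun x => Real.sqrt (g x), hs, fun x => Real.sqrt_pos.2 (hpos x),
    (hs.mono hm le_rfl).aestronglyMeasurable, ?_⟩
  refine (eLpNorm_lt_top_iff_lintegral_rpow_enorm_lt_top (by simp) (by simp)).2 ?_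
  rw [lintegral_trim hm (by fun_prop)] at hlt
  refine lt_of_le_of_lt (lintegral_mono fun x => ?_) (hlt.trans ENNReal.one_lt_top)
  rw [Real.enorm_eq_ofReal (Real.sqrt_nonneg _), ENNReal.toReal_ofNat, ENNReal.rpow_ofNat,
    ← ENNReal.ofReal_pow (Real.sqrt_nonneg _), Real.sq_sqrt (g x).coe_nonneg]
  simp

end CondExpL2

/-! ### The measures `μ_{wₙ} ∘ φ⁻ⁿ` and the powers of `C_{φ,w}` -/

theorem weight_succ {X : Type*} (φ : X → X) (w : X → ℂ) (n : ℕ) (x : X) :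
    weight φ w (n + 1) x = w x * weight φ w n (φ x) := by
  simp [weight, Finset.prod_range_succ', mul_comm]

variable {X : Type*} [MeasurableSpace X] {μ : Measure X} {φ : X → X} {w : X → ℂ}

theorem ae_weightedMeasure_iff (hw : Measurable w) {p : X → Prop} :
    (∀ᵐ x ∂weightedMeasure μ w, p x) ↔ ∀ᵐ x ∂μ, w x ≠ 0 → p x := by
  rw [weightedMeasure, ae_withDensity_iff (by fun_prop)]
  simp

theorem map_weightedMeasure_absolutelyContinuous_iff (hφ : Measurable φ) (hw : Measurable w) :
    (weightedMeasure μ w).map φ ≪ μ ↔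
      ∀ s, MeasurableSet s → μ s = 0 → ∀ᵐ x ∂μ, φ x ∈ s → w x = 0 := by
  have key {s : Set X} (hs : MeasurableSet s) :
      (weightedMeasure μ w).map φ s = 0 ↔ ∀ᵐ x ∂μ, φ x ∈ s → w x = 0 := by
    rw [Measure.map_apply hφ hs, measure_eq_zero_iff_ae_notMem, ae_weightedMeasure_iff hw]
    simp only [Set.mem_preimage, ne_eq, not_imp_not]
  exact ⟨fun h s hs h0 => (key hs).1 (h h0),
    fun h => Measure.AbsolutelyContinuous.mk fun s hs h0 => (key hs).2 (h s hs h0)⟩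

theorem measurable_weight (hφ : Measurable φ) (hw : Measurable w) (n : ℕ) :
    Measurable (weight φ w n) :=
  Finset.measurable_fun_prod _ fun j _ => hw.comp (hφ.iterate j)

theorem map_weight_absolutelyContinuous (hφ : Measurable φ) (hw : Measurable w)
    (hac : (weightedMeasure μ w).map φ ≪ μ) (n : ℕ) :
    (weightedMeasure μ (weight φ w n)).map φ^[n] ≪ μ := by
  induction n with
  | zero =>
    simpa using weightedMeasure_absolutelyContinuous μ _
  | succ n ih =>
    rw [map_weightedMeasure_absolutelyContinuous_iff (hφ.iterate _) (measurable_weight hφ hw _)]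
      at ih ⊢
    intro s hs h0
    have h := (ae_weightedMeasure_iff hw).1 (ae_of_ae_map hφ.aemeasurable (hac.ae_le (ih s hs h0)))
    filter_upwards [h] with x hx hxs
    rw [weight_succ, mul_eq_zero]
    exact or_iff_not_imp_left.2 fun h0 => hx h0 hxs

theorem weightedMeasure_map_eq [SigmaFinite μ] (hac : (weightedMeasure μ w).map φ ≪ μ) :
    (weightedMeasure μ w).map φ = μ.withDensity (rnd μ φ w) := by
  have : SFinite (weightedMeasure μ w) := by unfold weightedMeasure; infer_instance
  exact (Measure.withDensity_rnDeriv_eq _ _ hac).symm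

/-- `‖C_{φ,w} f‖² = ∫ h_{φ,w} |f|² dμ`, both sides possibly infinite. -/
theorem lintegral_wco_sq [SigmaFinite μ] (hφ : Measurable φ) (hw : Measurable w)
    (hac : (weightedMeasure μ w).map φ ≪ μ) {f : X → ℂ} (hf : Measurable f) :
    ∫⁻ x, ‖w x * f (φ x)‖ₑ ^ 2 ∂μ = ∫⁻ x, rnd μ φ w x * ‖f x‖ₑ ^ 2 ∂μ := by
  calc ∫⁻ x, ‖w x * f (φ x)‖ₑ ^ 2 ∂μ
      = ∫⁻ x, ‖f (φ x)‖ₑ ^ 2 ∂weightedMeasure μ w := by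
        rw [weightedMeasure, lintegral_withDensity_eq_lintegral_mul _
          (g := fun x => ‖f (φ x)‖ₑ ^ 2) (by fun_prop) (by fun_prop)]
        simp [enorm_mul, mul_pow]
    _ = ∫⁻ x, ‖f x‖ₑ ^ 2 ∂(weightedMeasure μ w).map φ :=
        (lintegral_map (f := fun x => ‖f x‖ₑ ^ 2) (by fun_prop) hφ).symm
    _ = ∫⁻ x, rnd μ φ w x * ‖f x‖ₑ ^ 2 ∂μ := by
        rw [weightedMeasure_map_eq hac, rnd, lintegral_withDensity_eq_lintegral_mul _
          (Measure.measurable_rnDeriv _ _) (by fun_prop)]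
        rfl

theorem ppow_wco_coeFn (hφ : Measurable φ) (hw : Measurable w)
    (hac : (weightedMeasure μ w).map φ ≪ μ) (n : ℕ) (f : (ppow (wco μ φ w hφ hw hac) n).domain) :
    (ppow (wco μ φ w hφ hw hac) n f : X → ℂ) =ᵐ[μ]
      fun x => weight φ w n x * (f : Lp ℂ 2 μ) (φ^[n] x) := by
  induction n with
  | zero =>
    simp only [weight, Finset.range_zero, Finset.prod_empty, one_mul, Function.iterate_zero, id]
    rfl
  | succ n ih =>
    obtain ⟨f, hf⟩ := f
    obtain ⟨h, h'⟩ := mem_pcomp_domain.1 hf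
    have h1 : (ppow (wco μ φ w hφ hw hac) (n + 1) ⟨f, hf⟩ : X → ℂ) =ᵐ[μ]
        fun x => w x * (ppow (wco μ φ w hφ hw hac) n ⟨f, h⟩) (φ x) :=
      MemLp.coeFn_toLp h'
    refine h1.trans ((ae_wco hφ hw hac (ih ⟨f, h⟩)).trans (ae_of_all _ fun x => ?_))
    simp [weight_succ, mul_assoc]

/-- Every `f` in the domain of `Cⁿ` has `∫ hₙ |f|² dμ < ∞`, hence vanishes on `{hₙ = ∞}`; a dense
domain therefore forces this set to be null. -/
theorem hn_lt_top [SigmaFinite μ] (hφ : Measurable φ) (hw : Measurable w)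
    (hac : (weightedMeasure μ w).map φ ≪ μ) (n : ℕ)
    (hd : Dense ((ppow (wco μ φ w hφ hw hac) n).domain : Set (Lp ℂ 2 μ))) :
    ∀ᵐ x ∂μ, hn μ φ w n x < ∞ := by
  have hmeas : Measurable (hn μ φ w n) := Measure.measurable_rnDeriv _ _
  have hzero (f : Lp ℂ 2 μ) (hf : f ∈ (ppow (wco μ φ w hφ hw hac) n).domain) :
      ∀ᵐ x ∂μ, hn μ φ w n x = ∞ → f x = 0 := by
    have hfm : Measurable (f : X → ℂ) := (Lp.stronglyMeasurable f).measurable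
    have h1 : MemLp (fun x => weight φ w n x * f (φ^[n] x)) 2 μ :=
      (memLp_congr_ae (ppow_wco_coeFn hφ hw hac n ⟨f, hf⟩)).1 (Lp.memLp _)
    have h2 : ∫⁻ x, hn μ φ w n x * ‖f x‖ₑ ^ 2 ∂μ ≠ ∞ := by
      have := lintegral_rpow_enorm_lt_top_of_eLpNorm_lt_top (by simp) (by simp) h1.2
      rw [hn, ← lintegral_wco_sq (hφ.iterate n) (measurable_weight hφ hw n)
        (map_weight_absolutelyContinuous hφ hw hac n) hfm]
      simpa using this.ne
    filter_upwards [ae_lt_top (by fun_prop) h2] with x hx htop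
    by_contra h0
    rw [htop, ENNReal.top_mul (by simpa using h0)] at hx
    exact lt_irrefl _ hx
  have hS : MeasurableSet {x | hn μ φ w n x = ∞} := hmeas (measurableSet_singleton _)
  have hS0 : μ {x | hn μ φ w n x = ∞} = 0 := by
    by_contra hne
    obtain ⟨T, hT, hTS, hT0, hTtop⟩ :=
      Measure.exists_subset_measure_lt_top hS (pos_iff_ne_zero.2 hne)
    -- The indicator `e` of a part of `{hₙ = ∞}` is orthogonal to the domain, so no element of the
    -- domain is closer to `e` than `0` is.
    set e : Lp ℂ 2 μ := indicatorConstLp 2 hT hTtop.ne 1 with he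
    have hepos : 0 < ‖e‖ := by
      rw [he, norm_indicatorConstLp (by simp) (by simp), norm_one, one_mul]
      exact Real.rpow_pos_of_pos (ENNReal.toReal_pos hT0.ne' hTtop.ne) _
    obtain ⟨f, hf, hfe⟩ := hd.exists_dist_lt e hepos
    rw [dist_eq_norm] at hfe
    refine absurd hfe (not_lt.2 (Lp.norm_le_norm_of_ae_le ?_))
    filter_upwards [hzero f hf, Lp.coeFn_sub e f, indicatorConstLp_coeFn (p := 2) (hs := hT)
      (hμs := hTtop.ne) (c := (1 : ℂ))] with x h1 h2 h3
    rw [h2, Pi.sub_apply, he, h3]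
    by_cases hx : x ∈ T
    · simp [hx, h1 (hTS hx)]
    · simp [hx]
  filter_upwards [measure_eq_zero_iff_ae_notMem.1 hS0] with x hx
  exact lt_top_iff_ne_top.2 hx

theorem sigmaFinite_trim_comap [SigmaFinite μ] (hφ : Measurable φ)
    (hac : (weightedMeasure μ w).map φ ≪ μ) (hfin : ∀ᵐ x ∂μ, rnd μ φ w x < ∞) :
    SigmaFinite ((weightedMeasure μ w).trim hφ.comap_le) := by
  have h : SigmaFinite ((weightedMeasure μ w).map φ) := by
    rw [weightedMeasure_map_eq hac]
    exact SigmaFinite.withDensity_of_ne_top (hfin.mono fun x hx => hx.ne)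
  rw [← map_trim_comap hφ] at h
  exact SigmaFinite.of_map _ (Measurable.of_comap_le le_rfl).aemeasurable h

/-! ### Commutation of `P_{φ,w}` with multiplication operators -/

theorem proj_coeFn (hφ : Measurable φ) (hw : Measurable w) (f : Lp ℂ 2 μ) :
    (proj μ φ w hφ hw f : X → ℂ) =ᵐ[μ]
      fun x => w x * (condExpL2 ℂ ℂ hφ.comap_le (divWeight μ w hw f) : X → ℂ) x :=
  MemLp.coeFn_toLp (memLp_mul_weight hw _)

theorem divWeight_coeFn (hw : Measurable w) (f : Lp ℂ 2 μ) :
    (divWeight μ w hw f : X → ℂ) =ᵐ[weightedMeasure μ w] fun x => f x / w x :=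
  MemLp.coeFn_toLp (memLp_div_weight hw f)

/-- The inclusion `P M_g ⊆ M_g P`, unfolded: `P (g f) = g P f` whenever `f, g f ∈ L²(μ)`. -/
theorem pcomp_proj_mulOp_le_iff (hφ : Measurable φ) (hw : Measurable w) (g : X → ℂ) :
    pcomp ((proj μ φ w hφ hw).toPMap ⊤) (mulOp μ g) ≤
        pcomp (mulOp μ g) ((proj μ φ w hφ hw).toPMap ⊤) ↔
      ∀ f k : Lp ℂ 2 μ, k =ᵐ[μ] (fun x => g x * f x) →
        proj μ φ w hφ hw k =ᵐ[μ] fun x => g x * proj μ φ w hφ hw f x := by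
  constructor
  · intro h f k hk
    have hf : MemLp (fun x => g x * f x) 2 μ := (memLp_congr_ae hk).1 (Lp.memLp k)
    have hfk : hf.toLp = k := (MemLp.toLp_congr _ (Lp.memLp k) hk.symm).trans (Lp.toLp_coeFn _ _)
    have hdom : f ∈ (pcomp ((proj μ φ w hφ hw).toPMap ⊤) (mulOp μ g)).domain :=
      mem_pcomp_domain.2 ⟨hf, trivial⟩
    obtain ⟨h1, h2⟩ := mem_pcomp_domain.1 (h.1 hdom)
    have h3 : proj μ φ w hφ hw hf.toLp = MemLp.toLp _ h2 :=
      h.2 (x := ⟨f, hdom⟩) (y := ⟨f, h.1 hdom⟩) rfl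
    rw [← hfk, h3]
    exact MemLp.coeFn_toLp _
  · intro h
    have key (f : Lp ℂ 2 μ) (hf : MemLp (fun x => g x * f x) 2 μ) := h f _ hf.coeFn_toLp
    refine ⟨fun f hf => ?_, ?_⟩
    · obtain ⟨h1, -⟩ := mem_pcomp_domain.1 hf
      exact mem_pcomp_domain.2 ⟨trivial, (memLp_congr_ae (key f h1)).1 (Lp.memLp _)⟩
    · rintro ⟨f, hf⟩ ⟨_, hf'⟩ (rfl : f = _)
      obtain ⟨h1, -⟩ := mem_pcomp_domain.1 hf
      obtain ⟨_, h2⟩ := mem_pcomp_domain.1 hf'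
      refine Lp.ext ((key f h1).trans ?_)
      exact (MemLp.coeFn_toLp h2).symm

/-- If `g` is `φ⁻¹(𝒜)`-measurable, the pull-out property gives `P (g f) = g P f`. -/
theorem proj_mul_of_aestronglyMeasurable (hφ : Measurable φ) (hw : Measurable w) {g : X → ℂ}
    (hg : AEStronglyMeasurable[MeasurableSpace.comap φ inferInstance] g (weightedMeasure μ w))
    {f k : Lp ℂ 2 μ} (hk : k =ᵐ[μ] fun x => g x * f x) :
    proj μ φ w hφ hw k =ᵐ[μ] fun x => g x * proj μ φ w hφ hw f x := by
  have h1 : (divWeight μ w hw k : X → ℂ) =ᵐ[weightedMeasure μ w]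
      fun x => g x * divWeight μ w hw f x := by
    filter_upwards [divWeight_coeFn hw k, divWeight_coeFn hw f,
      (weightedMeasure_absolutelyContinuous μ w).ae_le hk] with x h1 h2 h3
    rw [h1, h2, h3, mul_div_assoc]
  filter_upwards [proj_coeFn hφ hw k, proj_coeFn hφ hw f,
    ae_mul_of_ae_weighted hw (condExpL2_mul hφ.comap_le hg h1)] with x h1 h2 h3
  rw [h1, h2, h3, mul_left_comm]

/-- Conversely, let `P` commute with `g ≥ 0` and let `s > 0` be `φ⁻¹(𝒜)`-measurable in `L²(μ_w)`.
For `f = w s / (1 + g)` both `f` and `g f` lie in `L²(μ)` and add up to `w s`, which `P` fixes, so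
`(1 + g) P f = w s`. Hence `1 + g = s / E(s / (1 + g))` is `φ⁻¹(𝒜)`-measurable. -/
theorem aestronglyMeasurable_of_proj_mul (hφ : Measurable φ) (hw : Measurable w)
    [SigmaFinite ((weightedMeasure μ w).trim hφ.comap_le)] {g : X → ℝ} (hg : Measurable g)
    (hg0 : ∀ x, 0 ≤ g x)
    (h : ∀ f k : Lp ℂ 2 μ, k =ᵐ[μ] (fun x => (g x : ℂ) * f x) →
      proj μ φ w hφ hw k =ᵐ[μ] fun x => (g x : ℂ) * proj μ φ w hφ hw f x) :
    AEStronglyMeasurable[MeasurableSpace.comap φ inferInstance] g (weightedMeasure μ w) := by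
  obtain ⟨s, hs, hspos, hsL⟩ := exists_pos_sq_integrable (μ := weightedMeasure μ w) hφ.comap_le
  have hs' : Measurable s := hs.mono hφ.comap_le le_rfl
  have h1g (x : X) : (1 + g x : ℂ) ≠ 0 := by
    have := hg0 x
    exact_mod_cast (by positivity : (1 + g x) ≠ 0)
  have hws : MemLp (fun x => w x * s x) 2 μ := by
    refine ⟨by fun_prop, ?_⟩
    rw [eLpNorm_mul_weight μ hw (g := fun x => (s x : ℂ)) (by fun_prop)]
    exact hsL.ofReal.2
  have hf : MemLp (fun x => w x * s x / (1 + g x)) 2 μ := by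
    refine hws.mono (Measurable.aestronglyMeasurable (by fun_prop)) (ae_of_all _ fun x => ?_)
    rw [norm_div]
    refine div_le_self (norm_nonneg _) ?_
    rw [← Complex.ofReal_one, ← Complex.ofReal_add, Complex.norm_real, Real.norm_eq_abs,
      abs_of_nonneg] <;> linarith [hg0 x]
  have hk : MemLp (fun x => w x * s x - w x * s x / (1 + g x)) 2 μ := hws.sub hf
  have hkf : hk.toLp =ᵐ[μ] fun x => (g x : ℂ) * (hf.toLp : Lp ℂ 2 μ) x := by
    filter_upwards [hk.coeFn_toLp, hf.coeFn_toLp] with x h1 h2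
    rw [h1, h2]
    field_simp [h1g x]
    ring
  have hadd : hws.toLp = hk.toLp + hf.toLp := by
    rw [← MemLp.toLp_add]
    exact MemLp.toLp_congr _ _ (ae_of_all _ fun x => by simp)
  have hdiv : (divWeight μ w hw hws.toLp : X → ℂ) =ᵐ[weightedMeasure μ w] fun x => (s x : ℂ) := by
    filter_upwards [divWeight_coeFn hw hws.toLp,
      (weightedMeasure_absolutelyContinuous μ w).ae_le hws.coeFn_toLp,
      (ae_weightedMeasure_iff hw).2 (ae_of_all μ fun x hx => hx)] with x h1 h2 h3
    rw [h1, h2, mul_div_cancel_left₀ _ h3]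
  have hsC : Measurable[MeasurableSpace.comap φ inferInstance] fun x => (s x : ℂ) :=
    Complex.measurable_ofReal.comp hs
  have hfix : (condExpL2 ℂ ℂ hφ.comap_le (divWeight μ w hw hws.toLp) :
      Lp ℂ 2 (weightedMeasure μ w)) = divWeight μ w hw hws.toLp :=
    condExpL2_of_aestronglyMeasurable hφ.comap_le
      (hsC.stronglyMeasurable.aestronglyMeasurable.congr hdiv.symm)
  set e := (condExpL2 ℂ ℂ hφ.comap_le (divWeight μ w hw hf.toLp) :
      Lp ℂ 2 (weightedMeasure μ w)) with he
  have hmain : ∀ᵐ x ∂weightedMeasure μ w, (1 + g x : ℂ) * e x = s x := by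
    rw [ae_weightedMeasure_iff hw]
    filter_upwards [h _ _ hkf, proj_coeFn hφ hw hf.toLp, proj_coeFn hφ hw hws.toLp,
      Lp.coeFn_add (proj μ φ w hφ hw hk.toLp) (proj μ φ w hφ hw hf.toLp),
      (ae_weightedMeasure_iff hw).1 hdiv] with x h1 h2 h3 h4 h5 hx
    rw [hfix, h5 hx, hadd, map_add, h4, Pi.add_apply, h1, h2] at h3
    refine mul_left_cancel₀ hx ?_
    rw [← h3]
    ring
  have hem : AEStronglyMeasurable[MeasurableSpace.comap φ inferInstance] e (weightedMeasure μ w) :=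
    aestronglyMeasurable_condExpL2 hφ.comap_le _
  obtain ⟨e', he', hee'⟩ := hem
  refine ⟨fun x => ((s x : ℂ) / e' x).re - 1, ?_, ?_⟩
  · exact ((Complex.measurable_re.comp (hsC.div he'.measurable)).sub_const 1).stronglyMeasurable
  · filter_upwards [hmain, hee'] with x h1 h2
    have hs0 : (s x : ℂ) ≠ 0 := by exact_mod_cast (hspos x).ne'
    rw [h2] at h1
    have he0 : e' x ≠ 0 := fun h0 => hs0 (by rw [← h1, h0, mul_zero])
    rw [← h1, mul_div_cancel_right₀ _ he0]
    simp

/-! ### Functions fixed by `E_{φ,w}` -/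

theorem condE_eq_self_of_aestronglyMeasurable (hφ : Measurable φ)
    [SigmaFinite ((weightedMeasure μ w).trim hφ.comap_le)] {h : X → ℝ≥0∞}
    (hfin : ∀ᵐ x ∂weightedMeasure μ w, h x < ∞)
    (hm : AEStronglyMeasurable[MeasurableSpace.comap φ inferInstance] (fun x => (h x).toReal)
      (weightedMeasure μ w)) :
    condE μ φ w h =ᵐ[weightedMeasure μ w] h := by
  obtain ⟨k, hk, hhk⟩ := hm
  have h1 : h =ᵐ[weightedMeasure μ w] fun x => ENNReal.ofReal (k x) := by
    filter_upwards [hfin, hhk] with x h1 h2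
    rw [← h2, ENNReal.ofReal_toReal h1.ne]
  have h2 := condLExp_eq_self hφ.comap_le (weightedMeasure μ w) hk.measurable.ennreal_ofReal
  refine (condLExp_congr_ae h1).trans ?_
  rw [h2]
  exact h1.symm

theorem aestronglyMeasurable_of_condE_eq_self {h : X → ℝ≥0∞}
    (he : condE μ φ w h =ᵐ[weightedMeasure μ w] h) :
    AEStronglyMeasurable[MeasurableSpace.comap φ inferInstance] (fun x => ((h x).toReal : ℂ))
      (weightedMeasure μ w) := by
  have hm : Measurable[MeasurableSpace.comap φ inferInstance] (condE μ φ w h) :=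
    measurable_condLExp _ _ _
  refine ⟨fun x => ((condE μ φ w h x).toReal : ℂ),
    (Complex.measurable_ofReal.comp hm.ennreal_toReal).stronglyMeasurable, ?_⟩
  filter_upwards [he] with x hx
  rw [hx]

end WCO

theorem theorem3p2 {X : Type*} [MeasurableSpace X] (μ : Measure X) [SigmaFinite μ]
    (φ : X → X) (hφ : Measurable φ) (w : X → ℂ) (hw : Measurable w)
    (hac : (WCO.weightedMeasure μ w).map φ ≪ μ)
    (hC : ∀ n : ℕ, 1 ≤ n →
      Dense ((WCO.ppow (WCO.wco μ φ w hφ hw hac) n).domain : Set (Lp ℂ 2 μ)) ∧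
        (WCO.ppow (WCO.wco μ φ w hφ hw hac) n).IsClosed) :
    (∀ n : ℕ, 1 ≤ n →
      WCO.pcomp ((WCO.proj μ φ w hφ hw).toPMap ⊤) (WCO.mulOpENNReal μ (WCO.hn μ φ w n)) ≤
        WCO.pcomp (WCO.mulOpENNReal μ (WCO.hn μ φ w n)) ((WCO.proj μ φ w hφ hw).toPMap ⊤)) ↔
    (∀ n : ℕ, 1 ≤ n →
      WCO.condE μ φ w (WCO.hn μ φ w n) =ᵐ[WCO.weightedMeasure μ w] WCO.hn μ φ w n) := by
  have hfin (n : ℕ) (hn : 1 ≤ n) := WCO.hn_lt_top hφ hw hac n (hC n hn).1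
  have hmeas (n : ℕ) : Measurable (WCO.hn μ φ w n) := Measure.measurable_rnDeriv _ _
  have hw1 : WCO.weight φ w 1 = w := by ext x; simp [WCO.weight]
  have hfin1 : ∀ᵐ x ∂μ, WCO.rnd μ φ w x < ∞ := by
    simpa only [WCO.hn, hw1, Function.iterate_one] using hfin 1 le_rfl
  have := WCO.sigmaFinite_trim_comap hφ hac hfin1
  refine forall₂_congr fun n hn => ?_
  rw [WCO.mulOpENNReal, WCO.pcomp_proj_mulOp_le_iff]
  constructor
  · intro h
    exact WCO.condE_eq_self_of_aestronglyMeasurable hφ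
      ((WCO.weightedMeasure_absolutelyContinuous μ w).ae_le (hfin n hn))
      (WCO.aestronglyMeasurable_of_proj_mul hφ hw (hmeas n).ennreal_toReal
        (fun _ => ENNReal.toReal_nonneg) h)
  · intro h f k hk
    exact WCO.proj_mul_of_aestronglyMeasurable hφ hw
      (WCO.aestronglyMeasurable_of_condE_eq_self h) hk
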